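/- Let $k=\mathbb F_q$ be a finite field with algebraic closure $\bar k$, let $n\ge 0$, let $GL_n=GL_n(k)$ and $N=|GL_n|$, and let $d$ be a positive integer with $d\mid N$ or $N\mid d$. If $d\mid N$, let $\mathrm{Gal}(N,d)$ be the Galois group of $\mathbb Q(\zeta_N)$ over $\mathbb Q(\zeta_d)$; if $N\mid d$, let $\mathrm{Gal}(N,d)$ be trivial. For $\sigma\in\mathrm{Gal}(N,d)$ let $r=r_\sigma$ be the integer modulo $N$, coprime to $N$, with $\sigma(\zeta_N)=\zeta_N^{\,r}$. The group $\mathrm{Gal}(N,d)$ acts on the conjugacy classes of $GL_n$: $\sigma$ sends the class of $g$ to the class of $g^{r}$. The $d$-Galois classes of $GL_n$ are the unions of the conjugacy classes in the orbits of this action (one union for each orbit). Let $\Phi$ be the set of monic irreducible polynomials $f\ne t$ in $k[t]$ and $\mathscr P$ the set of all partitions. Let $\boldsymbol\mu:\Phi\to\mathscr P$ be a function with $\|\boldsymbol\mu\|=\sum_{f\in\Phi}|\boldsymbol\mu(f)|\deg f=n$. For $f=t^s-\sum_{i=1}^{s}a_it^{i-1}\in\Phi$ let $J(f)$ be the $s\times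 s$ companion matrix with ones directly above the diagonal, last row $(a_1,\dots,a_s)$ and zeros elsewhere; let $J_m(f)$ be the block matrix with $m$ diagonal blocks $J(f)$, identity blocks $I_s$ directly above them and zeros elsewhere; and let $J_\lambda(f)=\bigoplus_i J_{\lambda_i}(f)$ for a partition $\lambda=(\lambda_1,\lambda_2,\dots)$. Let $c_{\boldsymbol\mu}$ be the conjugacy class in $GL_n$ of $g_{\boldsymbol\mu}=\bigoplus_{f\in\Phi}J_{\boldsymbol\mu(f)}(f)$. For $\sigma\in\mathrm{Gal}(N,d)$ and $f\in\Phi$ with $\deg f\le n$, write $f=\prod_x(t-x)$ over $\bar k$ and put $\sigma.f=\prod_x(t-x^{r_\sigma})$, which is again an element of $\Phi$, of the same degree. Define $\sigma.\boldsymbol\mu:\Phi\to\mathscr P$ by $(\sigma.\boldsymbol\mu)(f)=\boldsymbol\mu(\sigma^{-1}.f)$ if $\deg f\le n$, and $(\sigma.\boldsymbol\mu)(f)=\emptyset$ if $\deg f>n$ (note that $\boldsymbol\mu(f)=\emptyset$ for $\deg f>n$). Let $\mathsf O_d(\boldsymbol\mu)=\{\sigma.\boldsymbol\mu:\sigma\in\mathrm{Gal}(N,d)\}$.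 **Theorem.** Let $\boldsymbol\mu,\boldsymbol\nu:\Phi\to\mathscr P$ with $\|\boldsymbol\mu\|=\|\boldsymbol\nu\|=n$. Then $c_{\boldsymbol\mu}$ and $c_{\boldsymbol\nu}$ lie in the same $d$-Galois class of $GL_n$ if and only if $\mathsf O_d(\boldsymbol\mu)=\mathsf O_d(\boldsymbol\nu)$. -/

import Mathlib

open Polynomial

/-! ### Galois groups of cyclotomic fields and Galois classes of a finite group -/

/-- The subfield of `ℚ(ζ_N)` generated by the `d`-th roots of unity that it contains. This is
`ℚ(ζ_d)` if `d ∣ N`, and it is all of `ℚ(ζ_N)` if `N ∣ d`. -/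
noncomputable def cyclotomicSubfield (N d : ℕ) : IntermediateField ℚ (CyclotomicField N ℚ) :=
  IntermediateField.adjoin ℚ {z : CyclotomicField N ℚ | z ^ d = 1}

/-- `Gal(N, d)`, the Galois group of `ℚ(ζ_N)` over `ℚ(ζ_d)` (for `d ∣ N`; it is trivial for
`N ∣ d`). -/
abbrev CyclotomicGal (N d : ℕ) : Type :=
  CyclotomicField N ℚ ≃ₐ[cyclotomicSubfield N d] CyclotomicField N ℚ

instance cyclotomicField_isCyclotomicExtension (N : ℕ) [NeZero N] :
    IsCyclotomicExtension {N} ℚ (CyclotomicField N ℚ) :=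
  CyclotomicField.isCyclotomicExtension N ℚ

/-- The exponent `r` with `σ ζ_N = ζ_N ^ r`; it is the representative in `{0, …, N - 1}` of a unit
modulo `N`. (Only for `N = 1` does this give `0`.) -/
noncomputable def galExponent {N d : ℕ} [NeZero N] (σ : CyclotomicGal N d) : ℕ :=
  (((IsCyclotomicExtension.zeta_spec N ℚ (CyclotomicField N ℚ)).autToPow
    (cyclotomicSubfield N d) σ : (ZMod N)ˣ) : ZMod N).val

/-- The action of `Gal(|G|, d)` on the conjugacy classes of `G` that sends the class of `g` to the
class of `g ^ r`, where `σ ζ = ζ ^ r`. -/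
noncomputable def galConjClass {G : Type*} [Group G] [Finite G] {d : ℕ}
    (σ : CyclotomicGal (Nat.card G) d) : ConjClasses G → ConjClasses G :=
  Quotient.map (fun g : G => g ^ galExponent σ) fun _ _ h => IsConj.pow _ h

/-- The `d`-Galois classes of `G`: for every orbit of `Gal(|G|, d)` on the conjugacy classes, the
union of the conjugacy classes in the orbit. -/
def galoisClasses (d : ℕ) (G : Type*) [Group G] [Finite G] : Set (Set G) :=
  Set.range fun c : ConjClasses G =>
    ⋃ σ : CyclotomicGal (Nat.card G) d, (galConjClass σ c).carrier

/-! ### Partition-valued functions -/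

/-- The monic irreducible polynomials over `k` other than `t`, that is, the minimal polynomials of
the nonzero elements of an algebraic closure of `k`. -/
abbrev MonicIrred (k : Type*) [Field k] : Type _ :=
  {f : k[X] // f.Monic ∧ Irreducible f ∧ f ≠ X}

/-- The set of all partitions (of all natural numbers). -/
abbrev AllPartitions : Type := Σ m : ℕ, m.Partition

namespace AllPartitions

/-- The size `|l|` of a partition. -/
abbrev size (l : AllPartitions) : ℕ := l.1

/-- The empty partition. -/
def empty : AllPartitions := ⟨0, Nat.Partition.indiscrete 0⟩

/-- The parts of a partition in weakly decreasing order. -/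
def partList (l : AllPartitions) : List ℕ := l.2.parts.sort (· ≥ ·)

theorem sum_partList (l : AllPartitions) : l.partList.sum = l.size := by
  have h : (l.partList : Multiset ℕ) = l.2.parts := Multiset.sort_eq _ _
  rw [← Multiset.sum_coe, h, l.2.parts_sum]

end AllPartitions

/-- Functions `μ` from the monic irreducible polynomials `f ≠ t` to partitions with
`‖μ‖ = ∑ |μ(f)| deg f = n`, a sum with finitely many nonzero terms. -/
structure PartitionFunction (k : Type*) [Field k] (n : ℕ) where
  toFun : MonicIrred k → AllPartitions
  finite_support : {f | (toFun f).size ≠ 0}.Finite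
  norm_eq : ∑ᶠ f, (toFun f).size * f.1.natDegree = n

/-! ### The conjugacy class attached to a partition-valued function -/

/-- The companion matrix `J(f)` of a monic polynomial `f = t^s - ∑_{i=1}^s a_i t^(i-1)`, with ones
above the diagonal and last row `(a_1, …, a_s)`. -/
def companionMatrix {k : Type*} [Field k] (f : k[X]) :
    Matrix (Fin f.natDegree) (Fin f.natDegree) k :=
  Matrix.of fun i j =>
    if (i : ℕ) + 1 = f.natDegree then -f.coeff j else if (j : ℕ) = i + 1 then 1 else 0

/-- The block matrix `J_m(f)` with `m` diagonal blocks `J(f)` and identity blocks right above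
them. -/
def jordanBlock {k : Type*} [Field k] (m : ℕ) (f : k[X]) :
    Matrix (Fin m × Fin f.natDegree) (Fin m × Fin f.natDegree) k :=
  Matrix.of fun a b =>
    if a.1 = b.1 then companionMatrix f a.2 b.2
    else if (b.1 : ℕ) = a.1 + 1 ∧ a.2 = b.2 then 1 else 0

/-- `J_l(f) = ⊕_i J_{l_i}(f)` for a partition `l = (l_1, l_2, …)`. -/
def jordanPartition {k : Type*} [Field k] (l : AllPartitions) (f : k[X]) :
    Matrix (Σ i : Fin l.partList.length, Fin (l.partList.get i) × Fin f.natDegree)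
      (Σ i : Fin l.partList.length, Fin (l.partList.get i) × Fin f.natDegree) k :=
  Matrix.blockDiagonal' fun i => jordanBlock (l.partList.get i) f

namespace PartitionFunction

variable {k : Type*} [Field k] {n : ℕ}

/-- The polynomials `f` for which `μ(f)` is not the empty partition. -/
abbrev Support (μ : PartitionFunction k n) : Type _ := {f : MonicIrred k // (μ.toFun f).size ≠ 0}

/-- The index set of the rows and columns of `g_μ`. -/
abbrev Index (μ : PartitionFunction k n) : Type _ :=
  Σ f : μ.Support, Σ i : Fin (μ.toFun f.1).partList.length,
    Fin ((μ.toFun f.1).partList.get i) × Fin f.1.1.natDegree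

open Classical in
/-- The Jordan canonical form `g_μ = ⊕_f J_{μ(f)}(f)` (polynomials with `μ(f) = ∅` contribute no
block). -/
noncomputable def jordanForm (μ : PartitionFunction k n) : Matrix μ.Index μ.Index k :=
  Matrix.blockDiagonal' fun f : μ.Support => jordanPartition (μ.toFun f.1) f.1.1

theorem natCard_index (μ : PartitionFunction k n) : Nat.card μ.Index = n := by
  classical
  have : Fintype μ.Support := μ.finite_support.fintype
  have h : ∀ f : μ.Support, Nat.card (Σ i : Fin (μ.toFun f.1).partList.length,
      Fin ((μ.toFun f.1).partList.get i) × Fin f.1.1.natDegree) =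
      (μ.toFun f.1).size * f.1.1.natDegree := by
    intro f
    rw [Nat.card_sigma]
    simp only [Nat.card_prod, Nat.card_fin]
    rw [← Finset.sum_mul, ← (μ.toFun f.1).sum_partList]
    congr 1
    simp
  rw [Nat.card_sigma, Finset.sum_congr rfl fun f _ => h f]
  refine Eq.trans ?_ μ.norm_eq
  rw [finsum_eq_sum_of_support_subset (s := μ.finite_support.toFinset)]
  · exact (Finset.sum_subtype _ (by simp) fun f => (μ.toFun f).size * f.1.natDegree).symm
  · intro f hf
    simp only [Function.mem_support, ne_eq, mul_eq_zero, not_or] at hf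
    simpa using hf.1

end PartitionFunction

theorem isUnit_companionMatrix {k : Type*} [Field k] {f : k[X]} (h0 : f.coeff 0 ≠ 0) :
    IsUnit (companionMatrix f) := by
  rw [← Matrix.mulVec_injective_iff_isUnit]
  refine (injective_iff_map_eq_zero (companionMatrix f).mulVecLin).2 fun v hv => ?_
  have hrow : ∀ i, ∑ j, companionMatrix f i j * v j = 0 := fun i => congrFun hv i
  have hpos : ∀ j : Fin f.natDegree, (j : ℕ) ≠ 0 → v j = 0 := by
    intro j hj
    have hlt : (j : ℕ) - 1 < f.natDegree := by omega
    have h := hrow ⟨(j : ℕ) - 1, hlt⟩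
    rw [Finset.sum_eq_single j] at h
    · simpa [companionMatrix, show (j : ℕ) - 1 + 1 = j by omega, j.2.ne] using h
    · intro b _ hb
      have hb' : (b : ℕ) ≠ j := fun e => hb (Fin.ext e)
      simp [companionMatrix, show (j : ℕ) - 1 + 1 = j by omega, j.2.ne, hb']
    · simp
  funext j
  by_cases hj : (j : ℕ) = 0
  · have hlt : f.natDegree - 1 < f.natDegree := by omega
    have h := hrow ⟨f.natDegree - 1, hlt⟩
    rw [Finset.sum_eq_single j] at h
    · have hs : f.natDegree - 1 + 1 = f.natDegree := by omega
      simpa [companionMatrix, hs, hj, h0] using h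
    · intro b _ hb
      rw [hpos b fun e => hb (Fin.ext (e.trans hj.symm)), mul_zero]
    · simp
  · exact hpos j hj

theorem isUnit_jordanBlock {k : Type*} [Field k] {f : k[X]} (h0 : f.coeff 0 ≠ 0) (m : ℕ) :
    IsUnit (jordanBlock m f) := by
  have hJ := Matrix.mulVec_injective_iff_isUnit.2 (isUnit_companionMatrix h0)
  rw [← Matrix.mulVec_injective_iff_isUnit]
  refine (injective_iff_map_eq_zero (jordanBlock m f).mulVecLin).2 fun v hv => ?_
  have hrow : ∀ a i, ∑ b, ∑ j, jordanBlock m f (a, i) (b, j) * v (b, j) = 0 := fun a i => by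
    rw [← Fintype.sum_prod_type']
    exact congrFun hv (a, i)
  -- the coordinates in the blocks `m - 1, m - 2, …` vanish, one block after the other
  have key : ∀ t : ℕ, ∀ a : Fin m, (a : ℕ) + t + 1 = m → ∀ j, v (a, j) = 0 := by
    intro t
    induction t with
    | zero =>
      intro a ha
      refine fun j => congrFun (hJ (a₁ := fun j => v (a, j)) (a₂ := 0) ?_) j
      rw [Matrix.mulVec_zero]
      funext i
      have h := hrow a i
      rw [Finset.sum_eq_single a] at h
      · simpa [jordanBlock, Matrix.mulVec, dotProduct] using h
      · intro b _ hb
        have hb' : (b : ℕ) ≠ a + 1 := by omega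
        simp [jordanBlock, hb.symm, hb']
      · simp
    | succ t ih =>
      intro a ha
      refine fun j => congrFun (hJ (a₁ := fun j => v (a, j)) (a₂ := 0) ?_) j
      rw [Matrix.mulVec_zero]
      funext i
      have h := hrow a i
      rw [Finset.sum_eq_single a] at h
      · simpa [jordanBlock, Matrix.mulVec, dotProduct] using h
      · intro b _ hb
        refine Finset.sum_eq_zero fun j _ => ?_
        by_cases hb' : (b : ℕ) = a + 1
        · rw [ih b (by omega) j, mul_zero]
        · simp [jordanBlock, hb.symm, hb']
      · simp
  funext ⟨a, j⟩
  exact key (m - 1 - a) a (by omega) j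

theorem isUnit_blockDiagonal' {k o : Type*} [Field k] [Fintype o] [DecidableEq o] {m : o → Type*}
    [∀ i, Fintype (m i)] [∀ i, DecidableEq (m i)] (M : ∀ i, Matrix (m i) (m i) k)
    (h : ∀ i, IsUnit (M i)) : IsUnit (Matrix.blockDiagonal' M) := by
  choose u hu using h
  refine IsUnit.of_mul_eq_one (Matrix.blockDiagonal' fun i => ((u i)⁻¹).val) ?_
  rw [← Matrix.blockDiagonal'_mul, ← Matrix.blockDiagonal'_one]
  congr 1
  funext i
  rw [← hu i]
  exact (u i).mul_inv

theorem MonicIrred.coeff_zero_ne {k : Type*} [Field k] (f : MonicIrred k) : f.1.coeff 0 ≠ 0 := by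
  intro h
  obtain ⟨hm, hi, hX⟩ := f.2
  exact hX (eq_of_monic_of_associated monic_X hm
    (Polynomial.irreducible_X.associated_of_dvd hi (X_dvd_iff.2 h))).symm

namespace PartitionFunction

variable {k : Type*} [Field k] {n : ℕ}

/-- An enumeration of the rows and columns of `g_μ`. -/
noncomputable def indexEquiv (μ : PartitionFunction k n) : μ.Index ≃ Fin n :=
  haveI : Finite μ.Support := μ.finite_support
  Finite.equivFinOfCardEq μ.natCard_index

theorem isUnit_jordanForm (μ : PartitionFunction k n) :
    IsUnit (Matrix.reindex μ.indexEquiv μ.indexEquiv μ.jordanForm) := by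
  classical
  have : Fintype μ.Support := μ.finite_support.fintype
  have h : IsUnit μ.jordanForm := by
    have h' : ∀ f : μ.Support, IsUnit (jordanPartition (μ.toFun f.1) f.1.1) := fun f =>
      isUnit_blockDiagonal' _ fun i => isUnit_jordanBlock f.1.coeff_zero_ne _
    exact isUnit_blockDiagonal' _ h'
  exact h.map (Matrix.reindexAlgEquiv k k μ.indexEquiv)

/-- The conjugacy class `c_μ` of `GL_n(k)`, the class of `g_μ`. It does not depend on the
enumeration of the rows and columns. -/
noncomputable def conjClass (μ : PartitionFunction k n) : ConjClasses (GL (Fin n) k) :=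
  ConjClasses.mk μ.isUnit_jordanForm.unit

end PartitionFunction

/-! ### The Galois action on partition-valued functions -/

/-- For `f = ∏ (t - x)` over an algebraic closure of `k`, the polynomial `∏ (t - x ^ r)`. -/
noncomputable def powRoots {k : Type*} [Field k] (r : ℕ) (f : k[X]) : (AlgebraicClosure k)[X] :=
  ((f.aroots (AlgebraicClosure k)).map fun x => X - C (x ^ r)).prod

namespace PartitionFunction

variable {k : Type*} [Field k] [Finite k] {n d : ℕ}

open Classical in
/-- The function `σ.μ : f ↦ μ(σ⁻¹.f)`, where `σ⁻¹.f` is the polynomial whose roots are the powers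
`x ^ r`, `x` a root of `f`, with the exponent `r` of `σ⁻¹`. If `deg f ≤ n`, then `σ⁻¹.f` is
again one of the irreducible polynomials on which `μ` is defined. For `deg f > n` it can be a
proper power of such a polynomial; the value is the empty partition then. -/
noncomputable def galAct (σ : CyclotomicGal (Nat.card (GL (Fin n) k)) d)
    (μ : PartitionFunction k n) : MonicIrred k → AllPartitions := fun f =>
  if h : ∃ g : MonicIrred k,
      g.1.map (algebraMap k (AlgebraicClosure k)) = powRoots (galExponent σ⁻¹) f.1
  then μ.toFun h.choose else AllPartitions.empty

/-- The orbit `O_d(μ) = {σ.μ : σ ∈ Gal(|GL_n(k)|, d)}`. -/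
def galOrbit (d : ℕ) (μ : PartitionFunction k n) : Set (MonicIrred k → AllPartitions) :=
  Set.range fun σ : CyclotomicGal (Nat.card (GL (Fin n) k)) d => galAct σ μ

end PartitionFunction

/-! The map `μ ↦ c_μ` is injective and equivariant for the two actions of `Gal(N, d)`, so it matches
their orbits.

Since `k` is perfect, `J_m(f)` is similar to multiplication by `X` on `k[X] / (f ^ m)`: evaluating
the separable `f` at the semisimple part plus a commuting nilpotent shift gives the shift times a
unit, so `f(J_m(f))` has nilpotency class exactly `m`. Injectivity follows because the nullity of
`f(g_μ) ^ j` is `deg f * ∑ min j m` over the parts `m` of `μ(f)`, which determines `μ(f)`.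

For equivariance, let `σ` have exponent `r` and let `h` be the minimal polynomial of `x ^ r`, where
`x` is a root of `f`. It has the degree of `f`, because `r` is invertible modulo
`q ^ (deg f) - 1`, which divides `N`. The `r`-th power of multiplication by `X` on `k[X] / (f ^ m)`
is again cyclic, with minimal polynomial `h ^ m`: if `m > 1`, then `n ≥ 2`, so `r` is prime to the
characteristic, `h(X ^ r)` is separable, and `f` divides it exactly once. -/

section Similarity

variable {R M N P : Type*} [CommRing R] [AddCommGroup M] [Module R M] [AddCommGroup N] [Module R N]
  [AddCommGroup P] [Module R P]

/-- Similarity of endomorphisms of possibly different modules: a linear equivalence conjugates one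
into the other. For square matrices over a field this is similarity of matrices whose index types
need not agree. -/
def IsSimilar (f : Module.End R M) (g : Module.End R N) : Prop :=
  ∃ e : M ≃ₗ[R] N, e.conj f = g

namespace IsSimilar

variable {f : Module.End R M} {g : Module.End R N} {h : Module.End R P}

theorem of_apply_eq (e : M ≃ₗ[R] N) (he : ∀ x, e (f x) = g (e x)) : IsSimilar f g :=
  ⟨e, LinearMap.ext fun y => by rw [LinearEquiv.conj_apply_apply, he, e.apply_symm_apply]⟩

theorem exists_apply_eq (H : IsSimilar f g) : ∃ e : M ≃ₗ[R] N, ∀ x, e (f x) = g (e x) := by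
  obtain ⟨e, rfl⟩ := H
  exact ⟨e, fun x => by rw [LinearEquiv.conj_apply_apply, e.symm_apply_apply]⟩

theorem symm (H : IsSimilar f g) : IsSimilar g f := by
  obtain ⟨e, rfl⟩ := H
  exact ⟨e.symm, e.conj.symm_apply_apply f⟩

theorem trans (H : IsSimilar f g) (H' : IsSimilar g h) : IsSimilar f h := by
  obtain ⟨e, rfl⟩ := H
  obtain ⟨e', rfl⟩ := H'
  exact ⟨e.trans e', LinearEquiv.conj_trans e e' ▸ rfl⟩

theorem aeval (H : IsSimilar f g) (p : R[X]) :
    IsSimilar (Polynomial.aeval f p) (Polynomial.aeval g p) := by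
  obtain ⟨e, rfl⟩ := H
  exact ⟨e, (aeval_algHom_apply (e.conjAlgEquiv R) f p).symm⟩

theorem pow (H : IsSimilar f g) (r : ℕ) : IsSimilar (f ^ r) (g ^ r) := by
  simpa only [map_pow, aeval_X] using H.aeval (X ^ r)

theorem finrank_ker_eq (H : IsSimilar f g) :
    Module.finrank R (LinearMap.ker f) = Module.finrank R (LinearMap.ker g) := by
  obtain ⟨e, he⟩ := H.exists_apply_eq
  have hker : (LinearMap.ker f).map (e : M →ₗ[R] N) = LinearMap.ker g := by
    ext y
    rw [Submodule.mem_map_equiv, LinearMap.mem_ker, LinearMap.mem_ker, ← e.map_eq_zero_iff, he,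
      e.apply_symm_apply]
  exact (hker ▸ e.finrank_map_eq _).symm

end IsSimilar

section Matrix

open scoped Matrix

variable {ι κ : Type*} [Fintype ι] [DecidableEq ι] [Fintype κ] [DecidableEq κ]

open LinearMap.GeneralLinearGroup Matrix.GeneralLinearGroup in
theorem isConj_iff_isSimilar_toLin' {g h : GL ι R} :
    IsConj g h ↔ IsSimilar (Matrix.toLin' g.1) (Matrix.toLin' h.1) := by
  have mul_eq_iff (c : GL ι R) : c * g = h * c ↔ ∀ v, c.1 *ᵥ (g.1 *ᵥ v) = h.1 *ᵥ (c.1 *ᵥ v) := by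
    simp only [Matrix.mulVec_mulVec, ← Units.val_mul, Units.ext_iff]
    exact ⟨fun H v => by rw [H], fun H => Matrix.mulVec_injective (funext H)⟩
  simp only [isConj_iff, mul_inv_eq_iff_eq_mul, mul_eq_iff]
  refine ⟨fun ⟨c, hc⟩ => .of_apply_eq (generalLinearEquiv R _ (toLin c)) hc, fun H => ?_⟩
  obtain ⟨e, he⟩ := H.exists_apply_eq
  obtain ⟨c, rfl⟩ := ((toLin (n := ι)).trans (generalLinearEquiv R (ι → R))).surjective e
  exact ⟨c, he⟩

theorem isSimilar_toLin'_reindex (e : ι ≃ κ) (A : Matrix ι ι R) :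
    IsSimilar (Matrix.toLin' A) (Matrix.toLin' (Matrix.reindex e e A)) := by
  refine ⟨LinearEquiv.funCongrLeft R R e.symm, ?_⟩
  rw [Matrix.toLin'_reindex]
  rfl

end Matrix

end Similarity

section DirectSum

variable {R o : Type*} [CommRing R] {M N : o → Type*} [∀ i, AddCommGroup (M i)]
  [∀ i, Module R (M i)] [∀ i, AddCommGroup (N i)] [∀ i, Module R (N i)]

variable (R M) in
/-- The direct sum of a family of endomorphisms, acting on the product of the modules. It is
bundled as an algebra homomorphism, so that it commutes with the evaluation of polynomials. -/
def endPi : (∀ i, Module.End R (M i)) →ₐ[R] Module.End R (∀ i, M i) :=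
  .ofLinearMap
    { toFun f := LinearMap.piMap f, map_add' _ _ := rfl, map_smul' _ _ := rfl } rfl fun _ _ => rfl

theorem aeval_endPi (f : ∀ i, Module.End R (M i)) (p : R[X]) :
    aeval (endPi R M f) p = endPi R M fun i => aeval (f i) p := by
  rw [aeval_algHom_apply]
  congr 1
  ext1 i
  rw [aeval_pi_apply]

theorem finrank_ker_endPi [StrongRankCondition R] [Fintype o] (f : ∀ i, Module.End R (M i))
    [∀ i, Module.Finite R (LinearMap.ker (f i))] [∀ i, Module.Free R (LinearMap.ker (f i))] :
    Module.finrank R (LinearMap.ker (endPi R M f)) =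
      ∑ i, Module.finrank R (LinearMap.ker (f i)) := by
  let inclusion : (∀ i, LinearMap.ker (f i)) →ₗ[R] ∀ i, M i :=
    .piMap fun i => (LinearMap.ker (f i)).subtype
  have range_inclusion : LinearMap.range inclusion = LinearMap.ker (endPi R M f) := by
    ext v
    refine ⟨?_, fun hv => ⟨fun i => ⟨v i, congrFun hv i⟩, rfl⟩⟩
    rintro ⟨w, rfl⟩
    exact funext fun i => (w i).2
  have inclusion_injective : Function.Injective inclusion := fun v w h =>
    funext fun i => Subtype.ext (congrFun h i)
  rw [← range_inclusion, LinearMap.finrank_range_of_inj inclusion_injective,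
    Module.finrank_pi_fintype]

namespace IsSimilar

protected theorem endPi {f : ∀ i, Module.End R (M i)} {g : ∀ i, Module.End R (N i)}
    (H : ∀ i, IsSimilar (f i) (g i)) : IsSimilar (endPi R M f) (endPi R N g) := by
  choose e he using fun i => (H i).exists_apply_eq
  exact .of_apply_eq (.piCongrRight e) fun v => funext fun i => he i (v i)

theorem endPi_comp_equiv {o' : Type*} (e : o' ≃ o) (f : ∀ i, Module.End R (M i)) :
    IsSimilar (endPi R (fun i => M (e i)) fun i => f (e i)) (endPi R M f) :=
  symm <| .of_apply_eq (LinearEquiv.piCongrLeft R M e).symm fun _ => rfl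

theorem toLin'_blockDiagonal' [Fintype o] [DecidableEq o] {ι : o → Type*} [∀ i, Fintype (ι i)]
    [∀ i, DecidableEq (ι i)] (A : ∀ i, Matrix (ι i) (ι i) R) :
    IsSimilar (Matrix.toLin' (Matrix.blockDiagonal' A))
      (endPi R (fun i => ι i → R) fun i => Matrix.toLin' (A i)) := by
  refine .of_apply_eq (LinearEquiv.piCurry R fun _ _ => R) fun v => funext₂ fun i a => ?_
  change ∑ b : Σ j, ι j, Matrix.blockDiagonal' A ⟨i, a⟩ b * v b = ∑ c, A i a c * v ⟨i, c⟩
  rw [Fintype.sum_sigma, Finset.sum_eq_single i (fun j _ hj => ?_) (by simp)]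
  · simp only [Matrix.blockDiagonal'_apply_eq]
  · exact Finset.sum_eq_zero fun c _ => by
      rw [Matrix.blockDiagonal'_apply_ne _ _ _ hj.symm, zero_mul]

end IsSimilar

end DirectSum

section Cyclic

open Module

variable {k : Type*} [Field k]

/-- Multiplication by the class of `X` on `k[X] / (q)`, the model of a cyclic endomorphism with
minimal polynomial `q`. -/
noncomputable def mulRoot (q : k[X]) : End k (AdjoinRoot q) :=
  Algebra.lmul k _ (AdjoinRoot.root q)

theorem aeval_mulRoot_apply_mk (q p a : k[X]) :
    aeval (mulRoot q) p (AdjoinRoot.mk q a) = AdjoinRoot.mk q (p * a) := by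
  rw [mulRoot, aeval_algHom_apply, AdjoinRoot.aeval_eq, map_mul]
  rfl

theorem aeval_mulRoot_eq_zero_iff {q p : k[X]} : aeval (mulRoot q) p = 0 ↔ q ∣ p := by
  rw [← AdjoinRoot.mk_eq_zero]
  refine ⟨fun h => ?_, fun h => LinearMap.ext fun x => ?_⟩
  · simpa only [aeval_mulRoot_apply_mk, mul_one, LinearMap.zero_apply] using
      LinearMap.congr_fun h (AdjoinRoot.mk q 1)
  · obtain ⟨a, rfl⟩ := AdjoinRoot.mk_surjective x
    rw [aeval_mulRoot_apply_mk, map_mul, h, zero_mul, LinearMap.zero_apply]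

theorem nilpotencyClass_aeval_mulRoot_pow {f P : k[X]} {m : ℕ} (hf : Irreducible f) (hm : m ≠ 0)
    (hfP : f ∣ P) (hP : 1 < m → Squarefree P) :
    nilpotencyClass (aeval (mulRoot (f ^ m)) P) = m := by
  obtain ⟨m, rfl⟩ := Nat.exists_eq_add_one_of_ne_zero hm
  refine nilpotencyClass_eq_succ_iff.2 ⟨?_, ?_⟩
  · rw [← map_pow, aeval_mulRoot_eq_zero_iff]
    exact pow_dvd_pow_of_dvd hfP _
  · rw [← map_pow, ne_eq, aeval_mulRoot_eq_zero_iff]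
    intro hdvd
    obtain ⟨u, rfl⟩ := hfP
    rw [mul_pow, pow_succ, mul_dvd_mul_iff_left (pow_ne_zero m hf.ne_zero)] at hdvd
    have m_ne_zero : m ≠ 0 := by
      rintro rfl
      exact hf.not_isUnit (isUnit_of_dvd_one (pow_zero u ▸ hdvd))
    exact hf.not_isUnit <| hP (by omega) f <| mul_dvd_mul_left f <| hf.prime.dvd_of_dvd_pow hdvd

theorem finrank_adjoinRoot (q : k[X]) : finrank k (AdjoinRoot q) = q.natDegree :=
  finrank_quotient_span_eq_natDegree

theorem finrank_range_aeval_mulRoot_mul {d q : k[X]} (hq : q ≠ 0) :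
    finrank k (LinearMap.range (aeval (mulRoot (d * q)) q)) = d.natDegree := by
  let φ : k[X] →ₗ[k] AdjoinRoot (d * q) :=
    aeval (mulRoot (d * q)) q ∘ₗ (AdjoinRoot.mkₐ (d * q)).toLinearMap
  have ker_φ : LinearMap.ker φ = (Ideal.span {d}).restrictScalars k := by
    ext a
    rw [Submodule.restrictScalars_mem, Ideal.mem_span_singleton, ← mul_dvd_mul_iff_right hq,
      mul_comm a, ← AdjoinRoot.mk_eq_zero, ← aeval_mulRoot_apply_mk]
    rfl
  have range_φ : LinearMap.range φ = LinearMap.range (aeval (mulRoot (d * q)) q) :=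
    LinearMap.range_comp_of_range_eq_top _ (LinearMap.range_eq_top.2 AdjoinRoot.mk_surjective)
  rw [← range_φ, ← φ.quotKerEquivRange.finrank_eq, ker_φ,
    (Submodule.Quotient.restrictScalarsEquiv k _).finrank_eq, finrank_quotient_span_eq_natDegree]

theorem finrank_ker_aeval_mulRoot {p q d p' q' : k[X]} (hp : p = d * p') (hq : q = d * q')
    (hq0 : q ≠ 0) (hcop : IsCoprime p' q') :
    finrank k (LinearMap.ker (aeval (mulRoot q) p)) = d.natDegree := by
  subst hp hq
  have ker_eq_range : LinearMap.ker (aeval (mulRoot (d * q')) (d * p')) =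
      LinearMap.range (aeval (mulRoot (d * q')) q') := by
    ext x
    obtain ⟨a, rfl⟩ := AdjoinRoot.mk_surjective x
    rw [LinearMap.mem_ker, aeval_mulRoot_apply_mk, AdjoinRoot.mk_eq_zero, mul_assoc,
      mul_dvd_mul_iff_left (left_ne_zero_of_mul hq0)]
    constructor
    · intro h
      obtain ⟨b, rfl⟩ := hcop.symm.dvd_of_dvd_mul_left h
      exact ⟨AdjoinRoot.mk _ b, aeval_mulRoot_apply_mk _ _ _⟩
    · rintro ⟨y, hy⟩
      obtain ⟨b, rfl⟩ := AdjoinRoot.mk_surjective y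
      rw [aeval_mulRoot_apply_mk, AdjoinRoot.mk_eq_mk] at hy
      exact ((dvd_sub_right (dvd_mul_right q' b)).1 ((dvd_mul_left q' d).trans hy)).mul_left p'
  rw [ker_eq_range, finrank_range_aeval_mulRoot_mul (right_ne_zero_of_mul hq0)]

theorem finrank_ker_aeval_mulRoot_pow {f : k[X]} (hf : f ≠ 0) (m j : ℕ) :
    finrank k (LinearMap.ker (aeval (mulRoot (f ^ m)) (f ^ j))) = min j m * f.natDegree := by
  rw [← natDegree_pow]
  refine finrank_ker_aeval_mulRoot (p' := f ^ (j - m)) (q' := f ^ (m - j)) ?_ ?_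
    (pow_ne_zero m hf) ?_
  · rw [← pow_add, show min j m + (j - m) = j by omega]
  · rw [← pow_add, show min j m + (m - j) = m by omega]
  · rcases le_total j m with h | h
    · simpa only [Nat.sub_eq_zero_of_le h, pow_zero] using isCoprime_one_left
    · simpa only [Nat.sub_eq_zero_of_le h, pow_zero] using isCoprime_one_right

theorem finrank_ker_aeval_mulRoot_of_isCoprime {p q : k[X]} (hq : q ≠ 0) (hpq : IsCoprime p q) :
    finrank k (LinearMap.ker (aeval (mulRoot q) p)) = 0 := by
  rw [finrank_ker_aeval_mulRoot (one_mul p).symm (one_mul q).symm hq hpq, natDegree_one]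

variable {V : Type*} [AddCommGroup V] [Module k V]

theorem pow_dvd_of_aeval_apply_eq_zero {T : End k V} {h : k[X]} (hh : Irreducible h) {m : ℕ} {v : V}
    (hv : aeval T (h ^ (m + 1)) v = 0) (hv' : aeval T (h ^ m) v ≠ 0) {p : k[X]}
    (hp : aeval T p v = 0) : h ^ (m + 1) ∣ p := by
  obtain ⟨a, b, hab⟩ := IsBezout.gcd_eq_sum p (h ^ (m + 1))
  have aeval_gcd : aeval T (IsBezout.gcd p (h ^ (m + 1))) v = 0 := by
    simp only [← hab, map_add, map_mul, LinearMap.add_apply, Module.End.mul_apply, hp, hv, map_zero,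
      add_zero]
  obtain ⟨i, -, hgcd⟩ := (dvd_prime_pow hh.prime _).1 (IsBezout.gcd_dvd_right p (h ^ (m + 1)))
  have hle : m + 1 ≤ i := by
    by_contra! hlt
    obtain ⟨c, hc⟩ := hgcd.dvd.trans (pow_dvd_pow h (Nat.lt_succ_iff.1 hlt))
    refine hv' ?_
    rw [hc, mul_comm, map_mul, Module.End.mul_apply, aeval_gcd, map_zero]
  exact (pow_dvd_pow h hle).trans (hgcd.symm.dvd.trans (IsBezout.gcd_dvd_left p _))

theorem isSimilar_mulRoot_pow [FiniteDimensional k V] {T : End k V} {h : k[X]}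
    (hh : Irreducible h) {m : ℕ} (hm : m ≠ 0) (hT : nilpotencyClass (aeval T h) = m)
    (hV : finrank k V = m * h.natDegree) :
    IsSimilar (mulRoot (h ^ m)) T := by
  obtain ⟨m, rfl⟩ := Nat.exists_eq_add_one_of_ne_zero hm
  obtain ⟨hT, hT'⟩ := nilpotencyClass_eq_succ_iff.1 hT
  rw [← map_pow] at hT hT'
  obtain ⟨v, hv⟩ : ∃ v, aeval T (h ^ m) v ≠ 0 := by
    by_contra! h0
    exact hT' (LinearMap.ext h0)
  let Θ : AdjoinRoot (h ^ (m + 1)) →ₐ[k] End k V :=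
    Ideal.Quotient.liftₐ (Ideal.span {h ^ (m + 1)}) (aeval T) fun p hp => by
      obtain ⟨c, rfl⟩ := Ideal.mem_span_singleton.1 hp
      rw [map_mul, hT, zero_mul]
  have Θ_root : Θ (AdjoinRoot.root _) = T := aeval_X T
  let φ : AdjoinRoot (h ^ (m + 1)) →ₗ[k] V := LinearMap.applyₗ v ∘ₗ Θ.toLinearMap
  have φ_injective : Function.Injective φ := by
    refine (injective_iff_map_eq_zero φ).2 fun x hx => ?_
    obtain ⟨p, rfl⟩ := AdjoinRoot.mk_surjective x
    exact AdjoinRoot.mk_eq_zero.2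
      (pow_dvd_of_aeval_apply_eq_zero hh (LinearMap.congr_fun hT v) hv hx)
  have := (AdjoinRoot.powerBasis (pow_ne_zero (m + 1) hh.ne_zero)).finite
  refine .of_apply_eq (φ.linearEquivOfInjective φ_injective ?_) fun x => ?_
  · rw [finrank_adjoinRoot, natDegree_pow, hV]
  · change Θ (AdjoinRoot.root _ * x) v = T (Θ x v)
    rw [map_mul, Θ_root, Module.End.mul_apply]

end Cyclic

section NilpotentPerturbation

variable {k : Type*} [CommRing k]

theorem nilpotencyClass_map_of_injective {R S F : Type*} [MonoidWithZero R] [MonoidWithZero S]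
    [FunLike F R S] [MonoidWithZeroHomClass F R S] {φ : F} (hφ : Function.Injective φ) (x : R) :
    nilpotencyClass (φ x) = nilpotencyClass x := by
  simp only [nilpotencyClass, ← map_pow, map_eq_zero_iff φ hφ]

theorem nilpotencyClass_eq_of_associated {R : Type*} [CommMonoidWithZero R] {x y : R}
    (h : Associated x y) : nilpotencyClass x = nilpotencyClass y := by
  simp only [nilpotencyClass, (h.pow_pow (n := _)).eq_zero_iff]

/-- In the Taylor expansion at `x` the constant term vanishes and the linear coefficient is a
unit. -/
theorem associated_aeval_add_of_isNilpotent {S : Type*} [CommRing S] [Algebra k S] {x y : S}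
    {f : k[X]} (hf : f.Separable) (hx : aeval x f = 0) (hy : IsNilpotent y) :
    Associated y (aeval (x + y) f) := by
  obtain ⟨z, hz⟩ := binomExpansion (f.map (algebraMap k S)) x y
  simp only [derivative_map, eval_map_algebraMap] at hz
  have isUnit_aeval_derivative : IsUnit (aeval x (derivative f)) := by
    obtain ⟨a, b, hab⟩ := hf
    refine IsUnit.of_mul_eq_one_right (aeval x b) ?_
    simpa [hx] using congrArg (aeval x) hab
  have isUnit_add := ((Commute.all z y).isNilpotent_mul_left hy).isUnit_add_left_of_commute
    isUnit_aeval_derivative (.all _ _)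
  refine ⟨isUnit_add.unit, ?_⟩
  rw [hz, hx, isUnit_add.unit_spec]
  ring

open scoped IsMulCommutative in
theorem nilpotencyClass_aeval_add_of_commute {A : Type*} [Ring A] [Algebra k A] {x y : A}
    {f : k[X]} (hf : f.Separable) (hxy : Commute x y) (hx : aeval x f = 0) (hy : IsNilpotent y) :
    nilpotencyClass (aeval (x + y) f) = nilpotencyClass y := by
  obtain ⟨S, _, hxS, hyS⟩ : ∃ S : Subalgebra k A, IsMulCommutative S ∧ x ∈ S ∧ y ∈ S := by
    refine ⟨Algebra.adjoin k {x, y}, Algebra.isMulCommutative_adjoin k ?_,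
      Algebra.subset_adjoin (by simp), Algebra.subset_adjoin (by simp)⟩
    rintro a (rfl | rfl) b (rfl | rfl)
    exacts [rfl, hxy, hxy.symm, rfl]
  have val_injective : Function.Injective S.val := Subtype.val_injective
  have hx' : aeval (⟨x, hxS⟩ : S) f = 0 := val_injective <| by rwa [← aeval_algHom_apply, map_zero]
  have hy' : IsNilpotent (⟨y, hyS⟩ : S) := (IsNilpotent.map_iff val_injective).1 hy
  have h := nilpotencyClass_eq_of_associated (associated_aeval_add_of_isNilpotent hf hx' hy')
  rw [← nilpotencyClass_map_of_injective val_injective,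
    ← nilpotencyClass_map_of_injective val_injective, ← aeval_algHom_apply] at h
  exact h.symm

end NilpotentPerturbation

section JordanBlock

open scoped Matrix

/-- The `m × m` matrix with ones right above the diagonal. -/
def shiftMatrix (R : Type*) [Zero R] [One R] (m : ℕ) : Matrix (Fin m) (Fin m) R :=
  .of fun a b => if (b : ℕ) = a + 1 then 1 else 0

theorem shiftMatrix_apply {R : Type*} [Zero R] [One R] {m : ℕ} (a b : Fin m) :
    shiftMatrix R m a b = if (b : ℕ) = a + 1 then 1 else 0 :=
  rfl

theorem shiftMatrix_pow_apply {R : Type*} [Semiring R] {m : ℕ} (j : ℕ) (a b : Fin m) :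
    (shiftMatrix R m ^ j) a b = if (b : ℕ) = a + j then 1 else 0 := by
  induction j generalizing b with
  | zero => simp [Matrix.one_apply, Fin.ext_iff, eq_comm]
  | succ j ih =>
    simp only [pow_succ, Matrix.mul_apply, ih, ite_mul, one_mul, zero_mul]
    by_cases h : (a : ℕ) + j < m
    · rw [Finset.sum_eq_single ⟨a + j, h⟩ (by simp +contextual [Fin.ext_iff]) (by simp)]
      simp [shiftMatrix_apply, add_assoc]
    · rw [Finset.sum_eq_zero fun c _ => if_neg (by omega), if_neg (by omega)]

theorem shiftMatrix_pow_self (R : Type*) [Semiring R] (m : ℕ) : shiftMatrix R m ^ m = 0 := by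
  ext a b
  rw [shiftMatrix_pow_apply, if_neg (by omega), Matrix.zero_apply]

theorem nilpotencyClass_shiftMatrix (R : Type*) [Semiring R] [Nontrivial R] (m : ℕ) :
    nilpotencyClass (shiftMatrix R m) = m := by
  cases m with
  | zero => exact nilpotencyClass_eq_zero_of_subsingleton
  | succ m =>
    refine nilpotencyClass_eq_succ_iff.2 ⟨shiftMatrix_pow_self R _, fun h => ?_⟩
    simpa [shiftMatrix_pow_apply] using congrFun₂ h 0 (Fin.last m)

variable {k : Type*} [Field k]

theorem companionMatrix_eq_transpose_leftMulMatrix {f : k[X]} (hf : f.Monic) :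
    companionMatrix f =
      (Algebra.leftMulMatrix (AdjoinRoot.powerBasisAux' hf) (AdjoinRoot.root f))ᵀ := by
  have leftMulMatrix_root := (AdjoinRoot.powerBasis' hf).leftMulMatrix
  rw [PowerBasis.minpolyGen_eq, AdjoinRoot.powerBasis'_gen, AdjoinRoot.minpoly_root hf.ne_zero,
    hf.leadingCoeff, inv_one, C_1, mul_one] at leftMulMatrix_root
  exact (congrArg Matrix.transpose leftMulMatrix_root).symm

theorem charpoly_companionMatrix {f : k[X]} (hf : f.Monic) : (companionMatrix f).charpoly = f := by
  rw [companionMatrix_eq_transpose_leftMulMatrix hf, Matrix.charpoly_transpose]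
  refine (charpoly_leftMulMatrix (AdjoinRoot.powerBasis' hf)).trans ?_
  rw [AdjoinRoot.powerBasis'_gen, AdjoinRoot.minpoly_root hf.ne_zero, hf.leadingCoeff, inv_one,
    C_1, mul_one]

theorem aeval_companionMatrix {f : k[X]} (hf : f.Monic) : aeval (companionMatrix f) f = 0 := by
  simpa only [charpoly_companionMatrix hf] using Matrix.aeval_self_charpoly (companionMatrix f)

theorem jordanBlock_eq_comp (m : ℕ) (f : k[X]) :
    jordanBlock m f = Matrix.compAlgEquiv (Fin m) (Fin f.natDegree) k k
      (Matrix.scalarAlgHom (Fin m) k (companionMatrix f) + shiftMatrix _ m) := by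
  ext ⟨a, i⟩ ⟨b, j⟩
  by_cases hab : a = b
  · subst hab
    simp [jordanBlock, shiftMatrix]
  · by_cases hb : (b : ℕ) = a + 1 <;> simp [jordanBlock, shiftMatrix, hab, hb, Matrix.one_apply]

theorem nilpotencyClass_aeval_jordanBlock {f : k[X]} (hf : f.Monic) (hfs : f.Separable)
    (hf0 : f.natDegree ≠ 0) (m : ℕ) : nilpotencyClass (aeval (jordanBlock m f) f) = m := by
  have : NeZero f.natDegree := ⟨hf0⟩
  set C := Matrix.scalarAlgHom (Fin m) k (companionMatrix f)
  set S := shiftMatrix (Matrix (Fin f.natDegree) (Fin f.natDegree) k) m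
  have aeval_C : aeval C f = 0 := by
    rw [aeval_algHom_apply, aeval_companionMatrix hf, map_zero]
  have commute_C_S : Commute C S := by
    ext a b : 1
    simp [C, S, shiftMatrix]
  rw [jordanBlock_eq_comp, aeval_algHom_apply,
    nilpotencyClass_map_of_injective (Matrix.compAlgEquiv ..).injective]
  exact (nilpotencyClass_aeval_add_of_commute hfs commute_C_S aeval_C
    ⟨m, shiftMatrix_pow_self _ _⟩).trans (nilpotencyClass_shiftMatrix _ m)

theorem isSimilar_mulRoot_pow_jordanBlock {f : k[X]} (hf : f.Monic) (hfi : Irreducible f)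
    (hfs : f.Separable) {m : ℕ} (hm : m ≠ 0) :
    IsSimilar (mulRoot (f ^ m)) (Matrix.toLin' (jordanBlock m f)) := by
  refine isSimilar_mulRoot_pow hfi hm ?_ ?_
  · change nilpotencyClass (aeval (Matrix.toLinAlgEquiv' (jordanBlock m f)) f) = m
    rw [aeval_algHom_apply, nilpotencyClass_map_of_injective Matrix.toLinAlgEquiv'.injective]
    exact nilpotencyClass_aeval_jordanBlock hf hfs hfi.natDegree_pos.ne' m
  · simp

end JordanBlock

section Power

variable {k : Type*} [Field k]

theorem separable_expand {h : k[X]} {r : ℕ} (hr : (r : k) ≠ 0) (hh : h.Separable)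
    (hX : IsCoprime h X) : (expand k r h).Separable := by
  have isUnit_r : IsUnit (r : k[X]) := C_eq_natCast (R := k) r ▸ isUnit_C.2 hr.isUnit
  have r_ne_zero : r ≠ 0 := by
    rintro rfl
    exact hr Nat.cast_zero
  have isCoprime_X : IsCoprime (expand k r h) X :=
    (IsCoprime.pow_right_iff (Nat.pos_of_ne_zero r_ne_zero)).1 <| by
      simpa using hX.map (expand k r).toRingHom
  rw [separable_def, derivative_expand]
  exact (IsCoprime.map hh (expand k r).toRingHom).mul_right <|
    (isCoprime_mul_unit_left_right isUnit_r _ _).2 isCoprime_X.pow_right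

theorem isSimilar_mulRoot_pow_pow {f h : k[X]} {m r : ℕ} (hf : Irreducible f) (hh : Irreducible h)
    (hdvd : f ∣ expand k r h) (hdeg : h.natDegree = f.natDegree) (hm : m ≠ 0)
    (hsq : 1 < m → Squarefree (expand k r h)) :
    IsSimilar (mulRoot (h ^ m)) (mulRoot (f ^ m) ^ r) := by
  have := (AdjoinRoot.powerBasis (pow_ne_zero m hf.ne_zero)).finite
  refine isSimilar_mulRoot_pow hh hm ?_ ?_
  · rw [← expand_aeval]
    exact nilpotencyClass_aeval_mulRoot_pow hf hm hdvd hsq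
  · rw [finrank_adjoinRoot, natDegree_pow, hdeg]

end Power

section CardGL

variable {k : Type*} [Field k] [Finite k] {n : ℕ}

theorem card_pow_sub_one_dvd_card_GL {s : ℕ} (hs : s ≠ 0) (hsn : s ≤ n) :
    Nat.card k ^ s - 1 ∣ Nat.card (GL (Fin n) k) := by
  have : Fintype k := Fintype.ofFinite k
  rw [Matrix.card_GL_field, Nat.card_eq_fintype_card]
  refine dvd_trans ?_ (Finset.dvd_prod_of_mem _ (Finset.mem_univ ⟨n - s, by omega⟩))
  refine ⟨Fintype.card k ^ (n - s), ?_⟩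
  rw [Nat.sub_mul, one_mul, ← pow_add, Nat.add_sub_cancel' hsn]

theorem card_dvd_card_GL (hn : 2 ≤ n) : Nat.card k ∣ Nat.card (GL (Fin n) k) := by
  have : Fintype k := Fintype.ofFinite k
  rw [Matrix.card_GL_field, Nat.card_eq_fintype_card]
  refine dvd_trans ?_ (Finset.dvd_prod_of_mem _ (Finset.mem_univ ⟨1, hn⟩))
  exact Nat.dvd_sub (dvd_pow_self _ (by omega)) (dvd_pow_self _ one_ne_zero)

theorem natCast_ne_zero_of_coprime_card_GL (hn : 2 ≤ n) {r : ℕ}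
    (hr : r.Coprime (Nat.card (GL (Fin n) k))) : (r : k) ≠ 0 := by
  have h := (hr.coprime_dvd_right (card_dvd_card_GL hn)).cast (R := k)
  have : Fintype k := Fintype.ofFinite k
  rw [Nat.card_eq_fintype_card, Nat.cast_card_eq_zero, isCoprime_zero_right] at h
  exact h.ne_zero

end CardGL

theorem isCoprime_of_monic_of_irreducible {k : Type*} [Field k] {f g : k[X]} (hf : f.Monic)
    (hfi : Irreducible f) (hg : g.Monic) (hgi : Irreducible g) (hfg : f ≠ g) : IsCoprime f g :=
  hfi.coprime_iff_not_dvd.2 fun hdvd =>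
    hfg <| eq_of_monic_of_associated hf hg <| hfi.associated_of_dvd hgi hdvd

namespace MonicIrred

variable {k : Type*} [Field k]

theorem monic (f : MonicIrred k) : f.1.Monic := f.2.1

theorem irreducible (f : MonicIrred k) : Irreducible f.1 := f.2.2.1

instance (f : MonicIrred k) : Fact (Irreducible f.1) := ⟨f.irreducible⟩

theorem isCoprime_of_ne {f g : MonicIrred k} (h : f ≠ g) : IsCoprime f.1 g.1 :=
  isCoprime_of_monic_of_irreducible f.monic f.irreducible g.monic g.irreducible
    (Subtype.coe_ne_coe.2 h)

theorem isCoprime_X (f : MonicIrred k) : IsCoprime f.1 X :=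
  isCoprime_of_monic_of_irreducible f.monic f.irreducible monic_X irreducible_X f.2.2.2

theorem eq_of_aeval_eq_zero {A : Type*} [Ring A] [Algebra k A] [Nontrivial A] {f g : MonicIrred k}
    {x : A} (hf : aeval x f.1 = 0) (hg : aeval x g.1 = 0) : f = g :=
  Subtype.ext <| (minpoly.eq_of_irreducible_of_monic f.irreducible hf f.monic).trans
    (minpoly.eq_of_irreducible_of_monic g.irreducible hg g.monic).symm

theorem aeval_root (f : MonicIrred k) : aeval (AdjoinRoot.root f.1) f.1 = 0 := by
  rw [AdjoinRoot.aeval_eq, AdjoinRoot.mk_self]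

theorem root_ne_zero (f : MonicIrred k) : AdjoinRoot.root f.1 ≠ 0 := fun h =>
  f.coeff_zero_ne <| (algebraMap k (AdjoinRoot f.1)).injective <| by
    rw [coeff_zero_eq_aeval_zero', ← h, f.aeval_root, map_zero]

theorem isIntegral_root (f : MonicIrred k) : IsIntegral k (AdjoinRoot.root f.1) :=
  ⟨f.1, f.monic, f.aeval_root⟩

/-- The minimal polynomial of `x ^ r` for a root `x` of `f`. It is the `σ.f` of the theorem for the
automorphisms `σ` with exponent `r` whenever it has the degree of `f`, see `map_minpolyPow`. -/
noncomputable def minpolyPow (r : ℕ) (f : MonicIrred k) : MonicIrred k :=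
  ⟨minpoly k (AdjoinRoot.root f.1 ^ r), minpoly.monic (f.isIntegral_root.pow r),
    minpoly.irreducible (f.isIntegral_root.pow r), fun h =>
      pow_ne_zero r f.root_ne_zero <| by simpa [h] using minpoly.aeval k (AdjoinRoot.root f.1 ^ r)⟩

theorem dvd_expand_minpolyPow (r : ℕ) (f : MonicIrred k) : f.1 ∣ expand k r (minpolyPow r f).1 := by
  rw [← AdjoinRoot.mk_eq_zero, ← AdjoinRoot.aeval_eq, expand_aeval]
  exact minpoly.aeval k _

theorem aeval_pow_minpolyPow {A : Type*} [Ring A] [Algebra k A] {f : MonicIrred k} {x : A}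
    (hx : aeval x f.1 = 0) (r : ℕ) : aeval (x ^ r) (minpolyPow r f).1 = 0 := by
  rw [← expand_aeval]
  exact aeval_eq_zero_of_dvd_aeval_eq_zero (dvd_expand_minpolyPow r f) hx

theorem minpolyPow_minpolyPow (r s : ℕ) (f : MonicIrred k) :
    minpolyPow s (minpolyPow r f) = minpolyPow (r * s) f :=
  eq_of_aeval_eq_zero (aeval_pow_minpolyPow (aeval_pow_minpolyPow f.aeval_root r) s)
    (pow_mul (AdjoinRoot.root f.1) r s ▸ aeval_pow_minpolyPow f.aeval_root (r * s))

theorem natDegree_minpolyPow_le (r : ℕ) (f : MonicIrred k) :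
    (minpolyPow r f).1.natDegree ≤ f.1.natDegree := by
  have := f.monic.finite_adjoinRoot
  exact (minpoly.natDegree_le _).trans_eq (finrank_adjoinRoot f.1)

theorem map_minpolyPow [PerfectField k] {r : ℕ} {f : MonicIrred k}
    (hdeg : (minpolyPow r f).1.natDegree = f.1.natDegree) :
    (minpolyPow r f).1.map (algebraMap k (AlgebraicClosure k)) = powRoots r f.1 := by
  set g := minpolyPow r f
  obtain ⟨x, hx⟩ : ∃ x : AlgebraicClosure k, aeval x f.1 = 0 :=
    IsAlgClosed.exists_aeval_eq_zero _ _ (degree_pos_of_irreducible f.irreducible).ne'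
  have aroots_subset : g.1.aroots (AlgebraicClosure k) ⊆
      (f.1.aroots (AlgebraicClosure k)).map (· ^ r) := by
    intro y hy
    have g_eq := minpoly.eq_of_irreducible_of_monic g.irreducible (aeval_pow_minpolyPow hx r)
      g.monic
    obtain ⟨σ, rfl⟩ := (isConjRoot_iff_mem_minpoly_aroots
      (Algebra.IsIntegral.isIntegral (x ^ r))).2 (g_eq ▸ hy) |>.symm.exists_algEquiv
    refine Multiset.mem_map.2 ⟨σ x, ?_, (map_pow σ x r).symm⟩
    rw [mem_aroots]
    exact ⟨f.monic.ne_zero, by rw [aeval_algHom_apply, hx, map_zero]⟩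
  have aroots_eq : g.1.aroots (AlgebraicClosure k) =
      (f.1.aroots (AlgebraicClosure k)).map (· ^ r) := by
    refine Multiset.eq_of_le_of_card_le ((Multiset.le_iff_subset ?_).2 aroots_subset) ?_
    · exact nodup_aroots_iff_of_splits g.monic.ne_zero (IsAlgClosed.splits _) |>.2
        (PerfectField.separable_of_irreducible g.irreducible)
    · rw [Multiset.card_map, IsAlgClosed.card_aroots_eq_natDegree,
        IsAlgClosed.card_aroots_eq_natDegree, hdeg]
  rw [(IsAlgClosed.splits _).eq_prod_roots_of_monic (g.monic.map _)]
  simp only [powRoots, aroots_eq, Multiset.map_map, Function.comp_def]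

theorem natDegree_eq_of_map_eq_powRoots {r : ℕ} {f g : k[X]}
    (h : g.map (algebraMap k (AlgebraicClosure k)) = powRoots r f) :
    g.natDegree = f.natDegree := by
  rw [← natDegree_map (algebraMap k (AlgebraicClosure k)), h, powRoots]
  change natDegree (Multiset.map ((X - C ·) ∘ (· ^ r)) (f.aroots (AlgebraicClosure k))).prod = _
  rw [← Multiset.map_map, natDegree_multiset_prod_X_sub_C_eq_card, Multiset.card_map,
    IsAlgClosed.card_aroots_eq_natDegree]

/-- The map `f ↦ minpolyPow r f` on the polynomials of degree at most `n`, extended by the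
identity, which makes it a permutation for suitable `r` (see `powPerm`). -/
noncomputable def powUpTo (n r : ℕ) (f : MonicIrred k) : MonicIrred k :=
  if f.1.natDegree ≤ n then minpolyPow r f else f

section Finite

variable [Finite k]

theorem root_pow_card_pow_sub_one (f : MonicIrred k) :
    AdjoinRoot.root f.1 ^ (Nat.card k ^ f.1.natDegree - 1) = 1 := by
  have := f.monic.finite_adjoinRoot
  have : Finite (AdjoinRoot f.1) := Module.finite_of_finite k
  have : Fintype (AdjoinRoot f.1) := Fintype.ofFinite _
  rw [← finrank_adjoinRoot, ← Module.natCard_eq_pow_finrank, Nat.card_eq_fintype_card]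
  exact FiniteField.pow_card_sub_one_eq_one _ f.root_ne_zero

theorem minpolyPow_eq_self {r : ℕ} {f : MonicIrred k}
    (hr : r ≡ 1 [MOD Nat.card k ^ f.1.natDegree - 1]) : minpolyPow r f = f := by
  have root_pow : AdjoinRoot.root f.1 ^ r = AdjoinRoot.root f.1 := by
    simpa using pow_eq_pow_of_modEq hr f.root_pow_card_pow_sub_one
  refine eq_of_aeval_eq_zero ?_ f.aeval_root
  simpa only [root_pow] using aeval_pow_minpolyPow f.aeval_root r

theorem natDegree_minpolyPow {r s : ℕ} {f : MonicIrred k}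
    (hrs : r * s ≡ 1 [MOD Nat.card k ^ f.1.natDegree - 1]) :
    (minpolyPow r f).1.natDegree = f.1.natDegree := by
  refine (natDegree_minpolyPow_le r f).antisymm ?_
  conv_lhs => rw [← minpolyPow_eq_self hrs, ← minpolyPow_minpolyPow]
  exact natDegree_minpolyPow_le s _

variable {n r s : ℕ}

theorem natDegree_powUpTo (hrs : r * s ≡ 1 [MOD Nat.card (GL (Fin n) k)]) (f : MonicIrred k) :
    (powUpTo n r f).1.natDegree = f.1.natDegree := by
  unfold powUpTo
  split_ifs with hf
  · exact natDegree_minpolyPow <| hrs.of_dvd <|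
      card_pow_sub_one_dvd_card_GL f.irreducible.natDegree_pos.ne' hf
  · rfl

theorem powUpTo_powUpTo (hrs : r * s ≡ 1 [MOD Nat.card (GL (Fin n) k)]) (f : MonicIrred k) :
    powUpTo n s (powUpTo n r f) = f := by
  rw [powUpTo, natDegree_powUpTo hrs, powUpTo]
  split_ifs with hf
  · exact (minpolyPow_minpolyPow r s f).trans <| minpolyPow_eq_self <| hrs.of_dvd <|
      card_pow_sub_one_dvd_card_GL f.irreducible.natDegree_pos.ne' hf
  · rfl

theorem powUpTo_dvd_expand (hsr : s * r ≡ 1 [MOD Nat.card (GL (Fin n) k)]) {f : MonicIrred k}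
    (hf : f.1.natDegree ≤ n) : (powUpTo n s f).1 ∣ expand k r f.1 := by
  have minpolyPow_eq : minpolyPow r (powUpTo n s f) = f :=
    .trans (if_pos ((natDegree_powUpTo hsr f).trans_le hf)).symm (powUpTo_powUpTo hsr f)
  conv_rhs => rw [← minpolyPow_eq]
  exact dvd_expand_minpolyPow r _

/-- The permutation `powUpTo n r`, for `r` invertible modulo the order of `GL_n(k)`. -/
noncomputable def powPerm (hrs : r * s ≡ 1 [MOD Nat.card (GL (Fin n) k)]) :
    Equiv.Perm (MonicIrred k) where
  toFun := powUpTo n r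
  invFun := powUpTo n s
  left_inv := powUpTo_powUpTo hrs
  right_inv := powUpTo_powUpTo (mul_comm r s ▸ hrs)

end Finite

end MonicIrred

section Partition

theorem sum_map_min_add_count (s : Multiset ℕ) (j : ℕ) :
    (s.map (min (j + 2))).sum + (s.map (min j)).sum + s.count (j + 1) =
      2 * (s.map (min (j + 1))).sum := by
  induction s using Multiset.induction_on with
  | empty => rfl
  | cons a s ih =>
    simp only [Multiset.map_cons, Multiset.sum_cons, Multiset.count_cons]
    split_ifs <;> omega

theorem eq_of_sum_map_min_eq {s t : Multiset ℕ} (hs : 0 ∉ s) (ht : 0 ∉ t)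
    (h : ∀ j, (s.map (min j)).sum = (t.map (min j)).sum) : s = t := by
  ext a
  cases a with
  | zero => rw [Multiset.count_eq_zero_of_notMem hs, Multiset.count_eq_zero_of_notMem ht]
  | succ j =>
    have hsj := sum_map_min_add_count s j
    rw [h, h, h, ← sum_map_min_add_count t j] at hsj
    exact Nat.add_left_cancel hsj

namespace AllPartitions

theorem ext_parts {l l' : AllPartitions} (h : l.2.parts = l'.2.parts) : l = l' := by
  obtain ⟨m, p⟩ := l
  obtain ⟨m', p'⟩ := l'
  obtain rfl : m = m' := p.parts_sum.symm.trans ((congrArg _ h).trans p'.parts_sum)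
  exact congrArg _ (Nat.Partition.ext h)

theorem eq_empty_of_size_eq_zero {l : AllPartitions} (h : l.size = 0) : l = empty := by
  obtain ⟨m, p⟩ := l
  obtain rfl : m = 0 := h
  exact congrArg _ (Subsingleton.elim _ _)

theorem parts_empty : empty.2.parts = 0 :=
  Nat.Partition.partition_zero_parts _

theorem coe_partList (l : AllPartitions) : (l.partList : Multiset ℕ) = l.2.parts :=
  Multiset.sort_eq _ _

theorem get_partList_mem_parts (l : AllPartitions) (i : Fin l.partList.length) :
    l.partList.get i ∈ l.2.parts := by
  rw [← l.coe_partList, Multiset.mem_coe]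
  exact List.get_mem _ _

theorem get_partList_ne_zero (l : AllPartitions) (i : Fin l.partList.length) :
    l.partList.get i ≠ 0 :=
  (l.2.parts_pos (l.get_partList_mem_parts i)).ne'

theorem get_partList_le_size (l : AllPartitions) (i : Fin l.partList.length) :
    l.partList.get i ≤ l.size :=
  (Multiset.le_sum_of_mem (l.get_partList_mem_parts i)).trans_eq l.2.parts_sum

theorem sum_get_partList (l : AllPartitions) (F : ℕ → ℕ) :
    ∑ i, F (l.partList.get i) = (l.2.parts.map F).sum := by
  rw [← l.coe_partList, Multiset.map_coe, Multiset.sum_coe, ← List.sum_ofFn]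
  exact congrArg _ (List.ofFn_getElem_eq_map _ _)

end AllPartitions

end Partition

namespace PartitionFunction

open Module

variable {k : Type*} [Field k] {n : ℕ}

theorem toFun_injective :
    Function.Injective (toFun : PartitionFunction k n → MonicIrred k → AllPartitions) := by
  rintro ⟨⟩ ⟨⟩ rfl
  rfl

theorem size_mul_natDegree_le (μ : PartitionFunction k n) (f : MonicIrred k) :
    (μ.toFun f).size * f.1.natDegree ≤ n := by
  refine (single_le_finsum (f := fun f => (μ.toFun f).size * f.1.natDegree) f
    (μ.finite_support.subset fun f hf => ?_) fun _ => Nat.zero_le _).trans_eq μ.norm_eq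
  exact left_ne_zero_of_mul hf

theorem size_le (μ : PartitionFunction k n) (f : MonicIrred k) : (μ.toFun f).size ≤ n :=
  (Nat.le_mul_of_pos_right _ f.irreducible.natDegree_pos).trans (μ.size_mul_natDegree_le f)

theorem natDegree_le (μ : PartitionFunction k n) {f : MonicIrred k} (hf : (μ.toFun f).size ≠ 0) :
    f.1.natDegree ≤ n :=
  (Nat.le_mul_of_pos_left _ (Nat.pos_of_ne_zero hf)).trans (μ.size_mul_natDegree_le f)

theorem toFun_eq_empty (μ : PartitionFunction k n) {f : MonicIrred k} (hf : n < f.1.natDegree) :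
    μ.toFun f = AllPartitions.empty :=
  AllPartitions.eq_empty_of_size_eq_zero <| by_contra fun h => hf.not_ge (μ.natDegree_le h)

noncomputable instance (μ : PartitionFunction k n) : Fintype μ.Support :=
  μ.finite_support.fintype

/-- The sum of the cyclic endomorphisms with minimal polynomials `f ^ m`, over all `f` and all
parts `m` of `μ(f)`: the module-theoretic counterpart of the matrix `g_μ`. -/
noncomputable def sumMulRoot (μ : PartitionFunction k n) :
    End k (∀ f : μ.Support, ∀ i : Fin (μ.toFun f.1).partList.length,
      AdjoinRoot (f.1.1 ^ (μ.toFun f.1).partList.get i)) :=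
  endPi k _ fun f => endPi k _ fun i => mulRoot (f.1.1 ^ (μ.toFun f.1).partList.get i)

theorem isSimilar_sumMulRoot_conjClass [PerfectField k] (μ : PartitionFunction k n) :
    IsSimilar μ.sumMulRoot (Matrix.toLin' μ.isUnit_jordanForm.unit.1) := by
  classical
  refine .trans (.trans ?_ (IsSimilar.toLin'_blockDiagonal' _).symm)
    (isSimilar_toLin'_reindex μ.indexEquiv μ.jordanForm)
  refine .endPi fun f => .trans ?_ (IsSimilar.toLin'_blockDiagonal' _).symm
  exact .endPi fun i => isSimilar_mulRoot_pow_jordanBlock f.1.monic f.1.irreducible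
    (PerfectField.separable_of_irreducible f.1.irreducible)
    ((μ.toFun f.1).get_partList_ne_zero i)

theorem finrank_ker_aeval_sumMulRoot (μ : PartitionFunction k n) (f : MonicIrred k) (j : ℕ) :
    finrank k (LinearMap.ker (aeval μ.sumMulRoot (f.1 ^ j))) =
      ((μ.toFun f).2.parts.map (min j)).sum * f.1.natDegree := by
  classical
  have finite_adjoinRoot (g : MonicIrred k) (m : ℕ) : Module.Finite k (AdjoinRoot (g.1 ^ m)) :=
    (g.monic.pow m).finite_adjoinRoot
  have finrank_ker_summand (g : μ.Support) :
      finrank k (LinearMap.ker (aeval (endPi k _ fun i : Fin (μ.toFun g.1).partList.length =>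
        mulRoot (g.1.1 ^ (μ.toFun g.1).partList.get i)) (f.1 ^ j))) =
      if g.1 = f then ((μ.toFun f).2.parts.map (min j)).sum * f.1.natDegree else 0 := by
    rw [aeval_endPi, finrank_ker_endPi]
    split_ifs with hg
    · subst hg
      rw [← AllPartitions.sum_get_partList, Finset.sum_mul]
      exact Finset.sum_congr rfl fun i _ =>
        finrank_ker_aeval_mulRoot_pow g.1.irreducible.ne_zero _ _
    · exact Finset.sum_eq_zero fun i _ => finrank_ker_aeval_mulRoot_of_isCoprime
        (pow_ne_zero _ g.1.irreducible.ne_zero) (MonicIrred.isCoprime_of_ne (Ne.symm hg)).pow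
  rw [sumMulRoot, aeval_endPi, finrank_ker_endPi]
  simp only [finrank_ker_summand]
  by_cases hf : (μ.toFun f).size = 0
  · rw [Fintype.sum_eq_zero _ fun g : μ.Support => if_neg fun h : g.1 = f => g.2 (h ▸ hf),
      AllPartitions.eq_empty_of_size_eq_zero hf, AllPartitions.parts_empty, Multiset.map_zero,
      Multiset.sum_zero, zero_mul]
  · rw [Fintype.sum_eq_single ⟨f, hf⟩ fun g hg => if_neg fun h => hg (Subtype.ext h), if_pos rfl]

theorem conjClass_injective [PerfectField k] :
    Function.Injective (conjClass : PartitionFunction k n → ConjClasses (GL (Fin n) k)) := by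
  intro μ ν h
  have isSimilar_sumMulRoot : IsSimilar μ.sumMulRoot ν.sumMulRoot :=
    μ.isSimilar_sumMulRoot_conjClass.trans <| .trans
      (isConj_iff_isSimilar_toLin'.1 (ConjClasses.mk_eq_mk_iff_isConj.1 h))
      ν.isSimilar_sumMulRoot_conjClass.symm
  refine toFun_injective <| funext fun f => AllPartitions.ext_parts <|
    eq_of_sum_map_min_eq (fun h => (Nat.Partition.parts_pos _ h).false)
      (fun h => (Nat.Partition.parts_pos _ h).false) fun j => ?_
  have finrank_eq := (isSimilar_sumMulRoot.aeval (f.1 ^ j)).finrank_ker_eq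
  rw [finrank_ker_aeval_sumMulRoot, finrank_ker_aeval_sumMulRoot] at finrank_eq
  exact Nat.eq_of_mul_eq_mul_right f.irreducible.natDegree_pos finrank_eq

/-- Precomposition with a degree-preserving permutation of the irreducible polynomials. -/
def compPerm (μ : PartitionFunction k n) (E : Equiv.Perm (MonicIrred k))
    (hE : ∀ f, (E f).1.natDegree = f.1.natDegree) : PartitionFunction k n where
  toFun f := μ.toFun (E f)
  finite_support := μ.finite_support.preimage E.injective.injOn
  norm_eq := by
    refine .trans ?_ μ.norm_eq
    rw [← finsum_comp_equiv E (f := fun f => (μ.toFun f).size * f.1.natDegree)]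
    exact finsum_congr fun f => by rw [hE]

theorem isSimilar_sumMulRoot_compPerm (μ : PartitionFunction k n) (E : Equiv.Perm (MonicIrred k))
    (hE : ∀ f, (E f).1.natDegree = f.1.natDegree) {r : ℕ}
    (hdvd : ∀ f : MonicIrred k, f.1.natDegree ≤ n → (E f).1 ∣ expand k r f.1)
    (hsq : 2 ≤ n → ∀ f : MonicIrred k, Squarefree (expand k r f.1)) :
    IsSimilar (μ.compPerm E hE).sumMulRoot (μ.sumMulRoot ^ r) := by
  let e : (μ.compPerm E hE).Support ≃ μ.Support := E.subtypeEquiv fun _ => Iff.rfl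
  let F (f : μ.Support) : End k (∀ i, AdjoinRoot (f.1.1 ^ (μ.toFun f.1).partList.get i)) :=
    endPi k _ fun i => mulRoot (f.1.1 ^ (μ.toFun f.1).partList.get i) ^ r
  have sumMulRoot_pow : μ.sumMulRoot ^ r = endPi k _ F := by
    rw [sumMulRoot, ← map_pow]
    exact congrArg _ (funext fun f => (map_pow _ _ r).symm)
  rw [sumMulRoot_pow]
  refine .trans (.endPi fun f => ?_) (.endPi_comp_equiv e F)
  have natDegree_le : f.1.1.natDegree ≤ n := PartitionFunction.natDegree_le _ f.2
  exact .endPi fun i => isSimilar_mulRoot_pow_pow (E f.1).irreducible f.1.irreducible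
    (hdvd _ natDegree_le) (hE _).symm (AllPartitions.get_partList_ne_zero _ i) fun hi =>
      hsq (hi.trans_le ((AllPartitions.get_partList_le_size _ i).trans (μ.size_le _))) f.1

end PartitionFunction

section GalExponent

variable {N d : ℕ} [NeZero N]

theorem galExponent_coprime (σ : CyclotomicGal N d) : (galExponent σ).Coprime N :=
  ZMod.val_coe_unit_coprime _

theorem natCast_galExponent (σ : CyclotomicGal N d) : (galExponent σ : ZMod N) =
    ((IsCyclotomicExtension.zeta_spec N ℚ (CyclotomicField N ℚ)).autToPow
      (cyclotomicSubfield N d) σ : (ZMod N)ˣ) :=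
  ZMod.natCast_zmod_val _

theorem galExponent_mul_modEq (σ τ : CyclotomicGal N d) :
    galExponent (σ * τ) ≡ galExponent τ * galExponent σ [MOD N] := by
  rw [← ZMod.natCast_eq_natCast_iff, Nat.cast_mul, natCast_galExponent, natCast_galExponent,
    natCast_galExponent, map_mul, Units.val_mul, mul_comm]

theorem galExponent_one_modEq : galExponent (1 : CyclotomicGal N d) ≡ 1 [MOD N] := by
  rw [← ZMod.natCast_eq_natCast_iff, natCast_galExponent, map_one, Units.val_one, Nat.cast_one]

theorem galExponent_inv_mul_modEq (σ : CyclotomicGal N d) :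
    galExponent σ⁻¹ * galExponent σ ≡ 1 [MOD N] :=
  (galExponent_mul_modEq σ σ⁻¹).symm.trans (mul_inv_cancel σ ▸ galExponent_one_modEq)

end GalExponent

section GaloisClasses

variable {G : Type*} [Group G] [Finite G] {d : ℕ}

noncomputable instance : MulAction (CyclotomicGal (Nat.card G) d) (ConjClasses G) where
  smul := galConjClass
  one_smul c := by
    obtain ⟨g, rfl⟩ := c.exists_rep
    exact congrArg ConjClasses.mk <|
      (pow_eq_pow_of_modEq galExponent_one_modEq pow_card_eq_one').trans (pow_one g)
  mul_smul σ τ c := by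
    obtain ⟨g, rfl⟩ := c.exists_rep
    exact congrArg ConjClasses.mk <|
      (pow_eq_pow_of_modEq (galExponent_mul_modEq σ τ) pow_card_eq_one').trans (pow_mul g _ _)

theorem carrier_subset_iUnion_galConjClass_iff {c b : ConjClasses G} :
    c.carrier ⊆ ⋃ σ : CyclotomicGal (Nat.card G) d, (galConjClass σ b).carrier ↔
      c ∈ MulAction.orbit (CyclotomicGal (Nat.card G) d) b := by
  constructor
  · intro h
    obtain ⟨g, rfl⟩ := c.exists_rep
    obtain ⟨σ, hσ⟩ := Set.mem_iUnion.1 (h ConjClasses.mem_carrier_mk)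
    exact ⟨σ, (ConjClasses.mem_carrier_iff_mk_eq.1 hσ).symm⟩
  · rintro ⟨σ, rfl⟩
    exact Set.subset_iUnion (fun σ : CyclotomicGal (Nat.card G) d => (galConjClass σ b).carrier) σ

theorem exists_galoisClasses_iff {c c' : ConjClasses G} :
    (∃ K ∈ galoisClasses d G, c.carrier ⊆ K ∧ c'.carrier ⊆ K) ↔
      MulAction.orbit (CyclotomicGal (Nat.card G) d) c =
        MulAction.orbit (CyclotomicGal (Nat.card G) d) c' := by
  simp only [galoisClasses, Set.exists_range_iff, carrier_subset_iUnion_galConjClass_iff,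
    ← MulAction.orbit_eq_iff]
  exact ⟨fun ⟨_, h, h'⟩ => h.trans h'.symm, fun h => ⟨c', h, rfl⟩⟩

end GaloisClasses

namespace PartitionFunction

variable {k : Type*} [Field k] [Finite k] {n d : ℕ}

/-- The function `σ.μ` of `galAct`, as a partition-valued function of the same norm. -/
noncomputable instance :
    SMul (CyclotomicGal (Nat.card (GL (Fin n) k)) d) (PartitionFunction k n) where
  smul σ μ := μ.compPerm (MonicIrred.powPerm (galExponent_inv_mul_modEq σ))
    (MonicIrred.natDegree_powUpTo (galExponent_inv_mul_modEq σ))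

theorem smul_toFun_apply (σ : CyclotomicGal (Nat.card (GL (Fin n) k)) d)
    (μ : PartitionFunction k n) (f : MonicIrred k) :
    (σ • μ).toFun f = μ.toFun (MonicIrred.powUpTo n (galExponent σ⁻¹) f) :=
  rfl

theorem conjClass_smul (σ : CyclotomicGal (Nat.card (GL (Fin n) k)) d)
    (μ : PartitionFunction k n) : (σ • μ).conjClass = σ • μ.conjClass := by
  have isSimilar_pow : IsSimilar (σ • μ).sumMulRoot (μ.sumMulRoot ^ galExponent σ) :=
    μ.isSimilar_sumMulRoot_compPerm _ _
      (fun f => MonicIrred.powUpTo_dvd_expand (galExponent_inv_mul_modEq σ)) fun hn f =>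
        (separable_expand (natCast_ne_zero_of_coprime_card_GL hn (galExponent_coprime σ))
          (PerfectField.separable_of_irreducible f.irreducible) f.isCoprime_X).squarefree
  refine ConjClasses.mk_eq_mk_iff_isConj.2 (isConj_iff_isSimilar_toLin'.2 ?_)
  rw [Units.val_pow_eq_pow_val, Matrix.toLin'_pow]
  exact (isSimilar_sumMulRoot_conjClass _).symm.trans <|
    isSimilar_pow.trans (μ.isSimilar_sumMulRoot_conjClass.pow _)

noncomputable instance :
    MulAction (CyclotomicGal (Nat.card (GL (Fin n) k)) d) (PartitionFunction k n) :=
  conjClass_injective.mulAction conjClass conjClass_smul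

theorem galAct_eq_smul_toFun (σ : CyclotomicGal (Nat.card (GL (Fin n) k)) d)
    (μ : PartitionFunction k n) : galAct σ μ = (σ • μ).toFun := by
  funext f
  have natDegree_eq := MonicIrred.natDegree_powUpTo (galExponent_inv_mul_modEq σ) f
  rw [smul_toFun_apply]
  by_cases hf : f.1.natDegree ≤ n
  · have powUpTo_eq : MonicIrred.powUpTo n (galExponent σ⁻¹) f =
        MonicIrred.minpolyPow (galExponent σ⁻¹) f := if_pos hf
    have map_eq := MonicIrred.map_minpolyPow (powUpTo_eq ▸ natDegree_eq)
    have exists_map_eq : ∃ g : MonicIrred k, g.1.map (algebraMap k (AlgebraicClosure k)) =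
        powRoots (galExponent σ⁻¹) f.1 := ⟨_, map_eq⟩
    rw [galAct, dif_pos exists_map_eq, powUpTo_eq]
    exact congrArg μ.toFun <| Subtype.ext <|
      map_injective _ (algebraMap k (AlgebraicClosure k)).injective <|
        exists_map_eq.choose_spec.trans map_eq.symm
  · rw [not_le] at hf
    rw [μ.toFun_eq_empty (hf.trans_eq natDegree_eq.symm), galAct]
    split_ifs with h
    · exact μ.toFun_eq_empty <| hf.trans_eq
        (MonicIrred.natDegree_eq_of_map_eq_powRoots h.choose_spec).symm
    · rfl

theorem galOrbit_eq_image (μ : PartitionFunction k n) :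
    galOrbit d μ = toFun '' MulAction.orbit (CyclotomicGal (Nat.card (GL (Fin n) k)) d) μ := by
  simp only [galOrbit, galAct_eq_smul_toFun, MulAction.orbit, ← Set.range_comp]
  rfl

end PartitionFunction

theorem mainTheorem5_general {k : Type*} [Field k] [Finite k] (n d : ℕ)
    (μ ν : PartitionFunction k n) :
    (∃ K ∈ galoisClasses d (GL (Fin n) k), μ.conjClass.carrier ⊆ K ∧ ν.conjClass.carrier ⊆ K) ↔
      PartitionFunction.galOrbit d μ = PartitionFunction.galOrbit d ν := by
  rw [exists_galoisClasses_iff, PartitionFunction.galOrbit_eq_image,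
    PartitionFunction.galOrbit_eq_image, PartitionFunction.toFun_injective.image_injective.eq_iff,
    MulAction.orbit_eq_iff, MulAction.orbit_eq_iff]
  refine exists_congr fun σ => ?_
  change σ • ν.conjClass = μ.conjClass ↔ σ • ν = μ
  rw [← PartitionFunction.conjClass_smul, PartitionFunction.conjClass_injective.eq_iff]

theorem mainTheorem5 {k : Type*} [Field k] [Finite k] (n d : ℕ) (hd : 0 < d)
    (hdvd : d ∣ Nat.card (GL (Fin n) k) ∨ Nat.card (GL (Fin n) k) ∣ d)
    (μ ν : PartitionFunction k n) :
    (∃ K ∈ galoisClasses d (GL (Fin n) k), μ.conjClass.carrier ⊆ K ∧ ν.conjClass.carrier ⊆ K) ↔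
      PartitionFunction.galOrbit d μ = PartitionFunction.galOrbit d ν :=
  mainTheorem5_general n d μ ν
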